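/- A $3$-graph is a $3$-uniform hypergraph. For a $3$-graph $G$ on a finite vertex set $V$ and $x,y\in V$ distinct, let $d_G(x,y)$ be the number of edges of $G$ containing both $x$ and $y$, and let $$\mathrm{co}_2(G)=\sum_{\{x,y\}\in\binom{V}{2}} d_G(x,y)^2 .$$ For a $3$-graph $F$, let $\mathrm{exco}_2(n,F)$ be the maximum of $\mathrm{co}_2(G)$ over all $3$-graphs $G$ on $n$ vertices that contain no copy of $F$ as a (not necessarily induced) subhypergraph. Let $S_s^3$ be the $3$-uniform star with $s$ edges: it has $2s+1$ vertices and $s$ edges, any two of which intersect exactly in one vertex that is common to all edges. Theorem. Let $s\ge 3$ be an integer. If $s$ is odd, then, as $n\to\infty$, $$\mathrm{exco}_2(n,S_s^3)=s(s-1)\,n^2\,(1+o(1)).$$ If $s$ is even, then, as $n\to\infty$, $$\mathrm{exco}_2(n,S_s^3)=\Bigl(s^2-\tfrac32 s\Bigr)n^2\,(1+o(1)).$$ -/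

import Mathlib

/-- A `k`-uniform hypergraph (`k`-graph) whose vertex set is the type `V`. -/
structure KGraph (k : ℕ) (V : Type*) where
  /-- The edges, a finite family of finite sets of vertices. -/
  edges : Finset (Finset V)
  /-- Every edge has exactly `k` vertices. -/
  uniform : (edges : Set (Finset V)).Sized k

namespace KGraph

/-- `G` contains a copy of `F`: some injection of the vertices of `F` into the vertices of `G`
maps every edge of `F` to an edge of `G` (the copy need not be induced). -/
def Contains {k : ℕ} {V W : Type*} (G : KGraph k V) (F : KGraph k W) : Prop :=
  ∃ f : W ↪ V, ∀ e ∈ F.edges, e.map f ∈ G.edges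

/-- `G` is `F`-free: `G` contains no copy of `F`. -/
def Free {k : ℕ} {V W : Type*} (G : KGraph k V) (F : KGraph k W) : Prop :=
  ¬ G.Contains F

/-- The codegree `d_G(T)`: the number of edges of `G` that contain the vertex set `T`. -/
def codegree {k : ℕ} {V : Type*} [DecidableEq V] (G : KGraph k V) (T : Finset V) : ℕ :=
  (G.edges.filter fun e => T ⊆ e).card

/-- The codegree squared sum `co₂(G)`: the sum of `d_G(T) ^ 2` over all `(k - 1)`-element sets
`T` of vertices. -/
def co2 {k : ℕ} {V : Type*} [Fintype V] [DecidableEq V] (G : KGraph k V) : ℕ :=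
  ∑ T ∈ (Finset.univ : Finset V).powersetCard (k - 1), G.codegree T ^ 2

/-- The codegree squared extremal function `exco₂(n, F)`: the maximum of `co₂(G)` over all
`F`-free `k`-graphs `G` on `n` vertices. -/
noncomputable def exco2 {k : ℕ} {W : Type*} (n : ℕ) (F : KGraph k W) : ℕ :=
  sSup {m : ℕ | ∃ G : KGraph k (Fin n), G.Free F ∧ G.co2 = m}

/-- The supremum in the definition of `exco2` is a maximum as soon as `F` has an edge. -/
theorem isGreatest_exco2 {k : ℕ} {W : Type*} (n : ℕ) (F : KGraph k W) (hF : F.edges.Nonempty) :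
    IsGreatest {m : ℕ | ∃ G : KGraph k (Fin n), G.Free F ∧ G.co2 = m} (exco2 n F) := by
  have hfin : Finite (KGraph k (Fin n)) :=
    Finite.of_injective (fun G : KGraph k (Fin n) => G.edges) fun G H h => by
      cases G; cases H; simp_all
  have hbdd : BddAbove {m : ℕ | ∃ G : KGraph k (Fin n), G.Free F ∧ G.co2 = m} :=
    ((Set.finite_range fun G : KGraph k (Fin n) => G.co2).subset
      (by rintro m ⟨G, -, rfl⟩; exact ⟨G, rfl⟩)).bddAbove
  refine ⟨Nat.sSup_mem ⟨_, ⟨∅, by simp [Set.Sized]⟩, ?_, rfl⟩ hbdd, fun m hm => le_csSup hbdd hm⟩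
  rintro ⟨f, hf⟩
  obtain ⟨e, he⟩ := hF
  simpa using hf e he

/-- The `3`-uniform star with `s` edges. The center is `none`, and the `i`-th edge consists of the
center and of the two vertices `(i, 0)` and `(i, 1)`, so that any two distinct edges meet exactly
in the center. -/
def star (s : ℕ) : KGraph 3 (Option (Fin s × Fin 2)) where
  edges := Finset.univ.image fun i : Fin s => {none, some (i, 0), some (i, 1)}
  uniform := by
    intro e he
    obtain ⟨i, -, rfl⟩ := Finset.mem_image.mp (Finset.mem_coe.mp he)
    rw [Finset.card_eq_three]
    exact ⟨none, some (i, 0), some (i, 1), by simp, by simp, by simp, rfl⟩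

end KGraph

/-! Call a pair heavy if its codegree is at least `2 * s`. If `s` heavy pairs met at a vertex `v`,
each could be extended by its own new vertex, giving a star; so the heavy pairs form a graph of
maximum degree below `s` (`Free.card_heavy_lt`). A link contains no matching of size `s`, since that
would also be a star. Hence the heavy pairs in the link of any vertex form a graph with degree and
matching number at most `s - 1`, and the Abbott–Hanson–Sauer theorem bounds their number by some
`f`.

Summing over all vertices, the heavy codegrees add up to at most `f * n`. Each of them is at most
`n`, so heavy pairs contribute at most `f * n ^ 2` to `co2`. There are only `O(n)` edges, and light
codegrees are bounded, so light pairs contribute `O(n)`.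

Conversely, take an extremal graph for Abbott–Hanson–Sauer on a fixed vertex set and join each of
its edges to every outside vertex. The result is star-free and each of the `f` pairs has codegree `n
- O(1)`. The value of `f` is `s * (s - 1)` for odd `s` and `s ^ 2 - 3 * s / 2` for even `s`.

The Abbott–Hanson–Sauer bound is derived from Gallai's lemma: if every vertex is missed by some
maximum matching, then "no maximum matching misses both" is transitive, and each of its classes has
all but at most one vertex covered by any maximum matching. -/

namespace SetMatching

/-! ### Maximum matchings and Gallai's lemma -/

open Finset

/-- `M` is a maximum matching of the set system `E`. -/
structure IsMaxMatching {V : Type*} (E M : Finset (Finset V)) : Prop where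
  subset : M ⊆ E
  disjoint : (M : Set (Finset V)).PairwiseDisjoint id
  max : ∀ N ⊆ E, (N : Set (Finset V)).PairwiseDisjoint id → N.card ≤ M.card

theorem exists_isMaxMatching {V : Type*} (E : Finset (Finset V)) : ∃ M, IsMaxMatching E M := by
  classical
  obtain ⟨M, hM, hmax⟩ := Finset.exists_max_image
    (E.powerset.filter fun M : Finset (Finset V) => (M : Set (Finset V)).PairwiseDisjoint id)
    Finset.card
    ⟨∅, by simp⟩
  simp only [mem_filter, mem_powerset] at hM hmax
  exact ⟨M, hM.1, hM.2, fun N h1 h2 => hmax N ⟨h1, h2⟩⟩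

variable {V : Type*} [DecidableEq V]

theorem card_biUnion_of_disjoint {M : Finset (Finset V)} (h2 : ∀ e ∈ M, e.card = 2)
    (hM : (M : Set (Finset V)).PairwiseDisjoint id) : (M.biUnion id).card = 2 * M.card := by
  exact (card_biUnion hM).trans ((sum_const_nat h2).trans (mul_comm _ _))

theorem pairwiseDisjoint_insert {N : Finset (Finset V)} {e : Finset V}
    (hN : (N : Set (Finset V)).PairwiseDisjoint id) (he : ∀ g ∈ N, Disjoint e g) :
    ((insert e N : Finset (Finset V)) : Set (Finset V)).PairwiseDisjoint id := by
  rw [coe_insert]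
  exact hN.insert fun g hg _ => he g hg

/-- A maximum matching meets every edge. -/
theorem IsMaxMatching.not_disjoint {E N : Finset (Finset V)} (hN : IsMaxMatching E N)
    {e : Finset V} (he : e ∈ E) (hne : e.Nonempty) : ∃ g ∈ N, ¬ Disjoint e g := by
  by_contra! h
  have heN : e ∉ N := fun h' => by simpa [hne.ne_empty] using h e h'
  have := hN.max (insert e N) (insert_subset he hN.subset) (pairwiseDisjoint_insert hN.disjoint h)
  rw [card_insert_of_notMem heN] at this
  omega

/-- Exchanging one edge brings a maximum matching that misses `v` closer to a given matching. -/
theorem IsMaxMatching.exists_exchange {E M N : Finset (Finset V)} (hE : ∀ e ∈ E, e.card = 2)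
    (hM : M ⊆ E) (hMd : (M : Set (Finset V)).PairwiseDisjoint id) (hN : IsMaxMatching E N)
    {v x : V} (hv : v ∉ N.biUnion id) (hxM : x ∈ M.biUnion id) (hxN : x ∉ N.biUnion id)
    (hxv : x ≠ v) :
    ∃ N', IsMaxMatching E N' ∧ v ∉ N'.biUnion id ∧ (M ∩ N).card < (M ∩ N').card := by
  simp only [mem_biUnion, id, not_exists, not_and] at hv hxM hxN
  obtain ⟨e, heM, hxe⟩ := hxM
  obtain ⟨g, hgN, heg⟩ := hN.not_disjoint (hM heM) ⟨x, hxe⟩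
  obtain ⟨y, hye, hyg⟩ := not_disjoint_iff.mp heg
  have hxy : x ≠ y := fun h => hxN g hgN (h ▸ hyg)
  have hexy : e = {x, y} := by
    refine (eq_of_subset_of_card_le ?_ ?_).symm
    · simp [insert_subset_iff, hxe, hye]
    · rw [hE e (hM heM), card_pair hxy]
  have heN : e ∉ N := fun h => hxN e h hxe
  have hgM : g ∉ M := fun h => by
    have : e = g := by
      by_contra hne
      exact disjoint_left.mp (hMd heM h hne) hye hyg
    exact heN (this ▸ hgN)
  have hcard : (insert e (N.erase g)).card = N.card := by
    rw [card_insert_of_notMem (fun h => heN (mem_of_mem_erase h)), card_erase_of_mem hgN]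
    have := card_pos.mpr ⟨g, hgN⟩
    omega
  -- Swap `g` for `e = {x, y}`. The vertex `v` stays uncovered because `x ≠ v`, and `y` was covered
  -- by `N` while `v` was not.
  refine ⟨insert e (N.erase g), ⟨?_, ?_, ?_⟩, ?_, ?_⟩
  · exact insert_subset (hM heM) ((erase_subset _ _).trans hN.subset)
  · refine pairwiseDisjoint_insert (hN.disjoint.subset (by simp)) fun h hh => ?_
    obtain ⟨hne, hh⟩ := mem_erase.mp hh
    rw [hexy, disjoint_insert_left, disjoint_singleton_left]
    exact ⟨hxN h hh, fun hy => disjoint_left.mp (hN.disjoint hh hgN hne) hy hyg⟩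
  · intro K hK hKd
    rw [hcard]
    exact hN.max K hK hKd
  · simp only [mem_biUnion, id, not_exists, not_and, mem_insert, mem_erase]
    rintro h (rfl | ⟨-, hh⟩)
    · rw [hexy]
      simp only [mem_insert, mem_singleton, not_or]
      exact ⟨hxv.symm, fun h => hv g hgN (h ▸ hyg)⟩
    · exact hv h hh
  · apply card_lt_card
    refine ⟨fun h hh => ?_, fun h => ?_⟩
    · obtain ⟨h1, h2⟩ := mem_inter.mp hh
      refine mem_inter.mpr ⟨h1, mem_insert_of_mem (mem_erase.mpr ⟨?_, h2⟩)⟩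
      rintro rfl
      exact hgM h1
    · exact heN (mem_inter.mp (h (mem_inter.mpr ⟨heM, mem_insert_self _ _⟩))).2

/-- Vertices `u` and `v` are inseparable if no maximum matching of `E` misses both. -/
def Insep (E : Finset (Finset V)) (u v : V) : Prop :=
  ∀ N, IsMaxMatching E N → u ∈ N.biUnion id ∨ v ∈ N.biUnion id

theorem insep_of_mem {E : Finset (Finset V)} {e : Finset V} (hE : ∀ e ∈ E, e.card = 2)
    (he : e ∈ E) {u v : V} (hu : u ∈ e) (hv : v ∈ e) (huv : u ≠ v) : Insep E u v := by
  intro N hN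
  have hexy : e = {u, v} := by
    refine (eq_of_subset_of_card_le ?_ ?_).symm
    · simp [insert_subset_iff, hu, hv]
    · rw [hE e he, card_pair huv]
  obtain ⟨g, hg, heg⟩ := hN.not_disjoint he ⟨u, hu⟩
  simp only [mem_biUnion, id]
  rw [hexy, disjoint_insert_left, disjoint_singleton_left] at heg
  by_cases h : u ∈ g
  · exact Or.inl ⟨g, hg, h⟩
  · exact Or.inr ⟨g, hg, by tauto⟩

/-- The key step of Gallai's lemma: inseparability is transitive through a vertex which is missed
by some maximum matching. -/
theorem Insep.trans {E : Finset (Finset V)} (hE : ∀ e ∈ E, e.card = 2) {u v w : V}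
    (hv : ∃ N, IsMaxMatching E N ∧ v ∉ N.biUnion id) (huv : Insep E u v) (hvw : Insep E v w)
    (huw : u ≠ w) : Insep E u w := by
  classical
  intro M hM
  by_contra! hmiss
  obtain ⟨huM, hwM⟩ := hmiss
  obtain ⟨N₀, hN₀, hvN₀⟩ := hv
  -- Among the maximum matchings missing `v`, take one sharing the most edges with `M`; an exchange
  -- will contradict this choice.
  obtain ⟨N, hN, hmax⟩ := Finset.exists_max_image
    (E.powerset.filter fun N => IsMaxMatching E N ∧ v ∉ N.biUnion id)
    (fun N => (M ∩ N).card) ⟨N₀, mem_filter.mpr ⟨mem_powerset.mpr hN₀.subset, hN₀, hvN₀⟩⟩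
  obtain ⟨-, hN, hvN⟩ := mem_filter.mp hN
  have huN := (huv N hN).resolve_right hvN
  have hwN := (hvw N hN).resolve_left hvN
  have hcard : (M.biUnion id).card = (N.biUnion id).card := by
    rw [card_biUnion_of_disjoint (fun e he => hE e (hM.subset he)) hM.disjoint,
      card_biUnion_of_disjoint (fun e he => hE e (hN.subset he)) hN.disjoint,
      le_antisymm (hN.max M hM.subset hM.disjoint) (hM.max N hN.subset hN.disjoint)]
  -- Both matchings cover equally many vertices and `N` covers `u` and `w`, which `M` misses. So `M`
  -- covers two vertices that `N` misses, one of them different from `v`.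
  have h2 : 1 < (M.biUnion id \ N.biUnion id).card := by
    rw [card_sdiff_comm hcard, one_lt_card]
    exact ⟨u, mem_sdiff.mpr ⟨huN, huM⟩, w, mem_sdiff.mpr ⟨hwN, hwM⟩, huw⟩
  obtain ⟨x, hx, hxv⟩ := exists_mem_ne h2 v
  obtain ⟨hxM, hxN⟩ := mem_sdiff.mp hx
  obtain ⟨N', hN', hvN', hlt⟩ := hN.exists_exchange hE hM.subset hM.disjoint hvN hxM hxN hxv
  exact (hmax N' (mem_filter.mpr ⟨mem_powerset.mpr hN'.subset, hN', hvN'⟩)).not_gt hlt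

/-! ### The Abbott–Hanson–Sauer bound -/

/-- The number of edges that a graph of maximum degree at most `k` on `2 * m + 1` vertices
can have. -/
def oddBound (k m : ℕ) : ℕ := min (m * (2 * m + 1)) (k * (2 * m + 1) / 2)

/-- If every vertex is missed by a maximum matching, the graph splits into parts on each of which
a maximum matching misses at most one vertex. -/
theorem card_le_of_forall_missed [Fintype V] {E : Finset (Finset V)} (hE : ∀ e ∈ E, e.card = 2)
    {k ν : ℕ} (hdeg : ∀ v, (E.filter fun e => v ∈ e).card ≤ k)
    (hν : ∀ M ⊆ E, (M : Set (Finset V)).PairwiseDisjoint id → M.card ≤ ν)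
    (hmiss : ∀ v, ∃ N, IsMaxMatching E N ∧ v ∉ N.biUnion id) :
    ∃ l : Multiset ℕ, l.sum ≤ ν ∧ E.card ≤ (l.map (oddBound k)).sum := by
  classical
  let S : Setoid V :=
    { r := fun u v => u = v ∨ Insep E u v
      iseqv :=
        { refl := fun u => Or.inl rfl
          symm := by
            rintro u v (h | h)
            · exact Or.inl h.symm
            · exact Or.inr fun N hN => (h N hN).symm
          trans := by
            rintro u v w (rfl | h) (rfl | h')
            · exact Or.inl rfl
            · exact Or.inr h'
            · exact Or.inr h
            · by_cases huw : u = w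
              · exact Or.inl huw
              · exact Or.inr (h.trans hE (hmiss v) h' huw) } }
  obtain ⟨M, hM⟩ := exists_isMaxMatching E
  let P : Quotient S → Finset V := fun c => univ.filter fun v => (⟦v⟧ : Quotient S) = c
  have hP : ∀ e ∈ E, ∀ v ∈ e, e ⊆ P ⟦v⟧ := by
    intro e he v hv u hu
    refine mem_filter.mpr ⟨mem_univ _, Quotient.sound ?_⟩
    by_cases huv : u = v
    · exact Or.inl huv
    · exact Or.inr (insep_of_mem hE he hu hv huv)
  have hne : ∀ e ∈ E, e.Nonempty := fun e he => card_pos.mp (by rw [hE e he]; omega)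
  refine ⟨univ.val.map fun c => (M.filter (· ⊆ P c)).card, ?_, ?_⟩
  · change ∑ c, (M.filter (· ⊆ P c)).card ≤ ν
    rw [← card_biUnion]
    · exact (card_le_card (biUnion_subset.mpr fun c _ => filter_subset _ _)).trans
        (hν M hM.subset hM.disjoint)
    · intro c _ d _ hcd
      refine disjoint_left.mpr fun e h1 h2 => hcd ?_
      obtain ⟨v, hv⟩ := hne e (hM.subset (mem_filter.mp h1).1)
      exact (mem_filter.mp ((mem_filter.mp h1).2 hv)).2.symm.trans
        (mem_filter.mp ((mem_filter.mp h2).2 hv)).2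
  · rw [Multiset.map_map]
    change E.card ≤ ∑ c, oddBound k (M.filter (· ⊆ P c)).card
    have hEc : E ⊆ univ.biUnion fun c => E.filter (· ⊆ P c) := by
      intro e he
      obtain ⟨v, hv⟩ := hne e he
      exact mem_biUnion.mpr ⟨⟦v⟧, mem_univ _, mem_filter.mpr ⟨he, hP e he v hv⟩⟩
    refine (card_le_card hEc).trans (card_biUnion_le.trans (sum_le_sum fun c _ => ?_))
    set m := (M.filter (· ⊆ P c)).card with hm
    -- Edges do not leave a class, so the covered vertices of `P c` lie in the `m` matching edges
    -- inside it. Two uncovered ones would be inseparable yet both missed by `M`.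
    have hPc : (P c).card ≤ 2 * m + 1 := by
      have hsub : P c ⊆ (M.filter (· ⊆ P c)).biUnion id ∪ (P c \ M.biUnion id) := by
        intro v hv
        by_cases hvM : v ∈ M.biUnion id
        · obtain ⟨e, he, hve⟩ := mem_biUnion.mp hvM
          refine mem_union_left _ (mem_biUnion.mpr ⟨e, mem_filter.mpr ⟨he, ?_⟩, hve⟩)
          have := hP e (hM.subset he) v hve
          rwa [(mem_filter.mp hv).2] at this
        · exact mem_union_right _ (mem_sdiff.mpr ⟨hv, hvM⟩)
      have h1 : (P c \ M.biUnion id).card ≤ 1 := by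
        refine card_le_one.mpr fun a ha b hb => ?_
        obtain ⟨ha, haM⟩ := mem_sdiff.mp ha
        obtain ⟨hb, hbM⟩ := mem_sdiff.mp hb
        have hab : (⟦a⟧ : Quotient S) = ⟦b⟧ :=
          (mem_filter.mp ha).2.trans (mem_filter.mp hb).2.symm
        rcases Quotient.exact hab with h | h
        · exact h
        · exact ((h M hM).elim haM hbM).elim
      have h2 := card_biUnion_of_disjoint (M := M.filter (· ⊆ P c))
        (fun e he => hE e (hM.subset (mem_filter.mp he).1))
        (hM.disjoint.subset (coe_subset.mpr (filter_subset _ _)))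
      have := (card_le_card hsub).trans (card_union_le _ _)
      omega
    refine le_min ?_ ?_
    · have hsub : E.filter (· ⊆ P c) ⊆ (P c).powersetCard 2 := fun e he =>
        mem_powersetCard.mpr ⟨(mem_filter.mp he).2, hE e (mem_filter.mp he).1⟩
      refine (card_le_card hsub).trans ?_
      rw [card_powersetCard]
      refine (Nat.choose_le_choose 2 hPc).trans ?_
      rw [Nat.choose_two_right, Nat.add_sub_cancel]
      refine (Nat.div_le_of_le_mul ?_)
      nlinarith
    · rw [Nat.le_div_iff_mul_le (by omega)]
      have h1 := sum_card_inter_le (s := P c) (B := E.filter (· ⊆ P c)) (n := k) fun v _ =>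
        (card_le_card (filter_subset_filter _ (filter_subset _ _))).trans (hdeg v)
      have h2 : ∑ e ∈ E.filter (· ⊆ P c), (P c ∩ e).card = (E.filter (· ⊆ P c)).card * 2 := by
        rw [sum_congr rfl (g := fun _ => 2), sum_const, smul_eq_mul]
        intro e he
        rw [inter_eq_right.mpr (mem_filter.mp he).2, hE e (mem_filter.mp he).1]
      rw [h2, mul_comm (P c).card] at h1
      exact h1.trans (Nat.mul_le_mul_left _ hPc)

/-- Induction on the matching number: a vertex covered by every maximum matching is deleted, at the
cost of at most `k` edges and one unit of `ν`; `a` counts these deletions. Once no such vertex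
exists, Gallai's lemma supplies `l`. -/
theorem exists_card_le [Fintype V] {k : ℕ} (ν : ℕ) : ∀ E : Finset (Finset V),
    (∀ e ∈ E, e.card = 2) → (∀ v, (E.filter fun e => v ∈ e).card ≤ k) →
    (∀ M ⊆ E, (M : Set (Finset V)).PairwiseDisjoint id → M.card ≤ ν) →
    ∃ (a : ℕ) (l : Multiset ℕ), a + l.sum ≤ ν ∧
      E.card ≤ k * a + (l.map (oddBound k)).sum := by
  induction ν with
  | zero =>
    intro E hE hdeg hν
    refine ⟨0, 0, by simp, ?_⟩
    simp only [mul_zero, Multiset.map_zero, Multiset.sum_zero, zero_add, nonpos_iff_eq_zero,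
      card_eq_zero]
    refine eq_empty_of_forall_notMem fun e he => ?_
    have := hν {e} (by simpa using he) (by simp)
    simp at this
  | succ ν ih =>
    intro E hE hdeg hν
    by_cases hmiss : ∀ v, ∃ N, IsMaxMatching E N ∧ v ∉ N.biUnion id
    · obtain ⟨l, h1, h2⟩ := card_le_of_forall_missed hE hdeg hν hmiss
      exact ⟨0, l, by omega, by omega⟩
    · push Not at hmiss
      obtain ⟨v, hv⟩ := hmiss
      obtain ⟨a, l, h1, h2⟩ := ih (E.filter fun e => v ∉ e)
        (fun e he => hE e (mem_filter.mp he).1)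
        (fun u => (card_le_card (filter_subset_filter _ (filter_subset _ _))).trans (hdeg u))
        -- A matching avoiding `v` with `ν + 1` edges would be maximum in `E`, but every maximum
        -- matching covers `v`.
        (fun M hM hMd => by
          by_contra! hlt
          have hME : M ⊆ E := hM.trans (filter_subset _ _)
          obtain ⟨e, he, hve⟩ := mem_biUnion.mp
            (hv M ⟨hME, hMd, fun N hN hNd => (hν N hN hNd).trans hlt⟩)
          exact (mem_filter.mp (hM he)).2 hve)
      refine ⟨a + 1, l, by omega, ?_⟩
      have := card_filter_add_card_filter_not (s := E) (fun e => v ∈ e)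
      have := hdeg v
      rw [mul_add]
      omega

theorem oddBound_le (k m : ℕ) : oddBound k m ≤ 2 * k * m := by
  rcases Nat.eq_zero_or_pos m with rfl | hm
  · simp [oddBound]
  · refine (min_le_right _ _).trans (Nat.div_le_of_le_mul ?_)
    nlinarith

/-- The clique term of the minimum suffices for `m ≤ j`, the degree term for `m ≥ j`. -/
theorem oddBound_even_le (j m : ℕ) : oddBound (2 * j) m ≤ (2 * j + 1) * m := by
  rcases le_total m j with h | h
  · refine (min_le_left _ _).trans ?_
    rw [mul_comm]
    gcongr
  · refine (min_le_right _ _).trans (Nat.div_le_of_le_mul ?_)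
    nlinarith

theorem oddBound_odd_le (j m : ℕ) : oddBound (2 * j + 1) m ≤ (2 * j + 1) * m + j := by
  refine (min_le_right _ _).trans ?_
  have : (2 * j + 1) * (2 * m + 1) = 2 * ((2 * j + 1) * m + j) + 1 := by ring
  omega

theorem oddBound_odd_le_of_le {j m : ℕ} (h : m ≤ j) :
    oddBound (2 * j + 1) m ≤ (2 * j + 1) * m := by
  refine (min_le_left _ _).trans ?_
  rw [mul_comm]
  gcongr

theorem sum_map_oddBound_le {k c : ℕ} {l : Multiset ℕ} (h : ∀ m ∈ l, oddBound k m ≤ c * m) :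
    (l.map (oddBound k)).sum ≤ c * l.sum := by
  refine (Multiset.sum_map_le_sum_map (oddBound k) (c * ·) h).trans ?_
  rw [Multiset.sum_map_mul_left, Multiset.map_id']

/-- Two entries above `j` would already add up to `2 * j + 2`, so at most one part brings in the
surplus `j` of `oddBound_odd_le`. -/
theorem sum_map_oddBound_odd_le {j : ℕ} {l : Multiset ℕ} (hl : l.sum ≤ 2 * j + 1) :
    (l.map (oddBound (2 * j + 1))).sum ≤ (2 * j + 1) * l.sum + j := by
  by_cases h : ∀ m ∈ l, m ≤ j
  · exact (sum_map_oddBound_le fun m hm => oddBound_odd_le_of_le (h m hm)).trans (by omega)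
  · push Not at h
    obtain ⟨m, hm, hjm⟩ := h
    obtain ⟨l', rfl⟩ := Multiset.exists_cons_of_mem hm
    rw [Multiset.sum_cons] at hl
    rw [Multiset.map_cons, Multiset.sum_cons, Multiset.sum_cons, mul_add]
    have h1 := oddBound_odd_le j m
    have h2 : (l'.map (oddBound (2 * j + 1))).sum ≤ (2 * j + 1) * l'.sum :=
      sum_map_oddBound_le fun a ha => oddBound_odd_le_of_le (by
        have := Multiset.le_sum_of_mem ha
        omega)
    omega

variable [Fintype V] {E : Finset (Finset V)}

/-- A crude bound on the number of edges of a graph in terms of its maximum degree and its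
matching number. -/
theorem card_le_two_mul (hE : ∀ e ∈ E, e.card = 2) {k ν : ℕ}
    (hdeg : ∀ v, (E.filter fun e => v ∈ e).card ≤ k)
    (hν : ∀ M ⊆ E, (M : Set (Finset V)).PairwiseDisjoint id → M.card ≤ ν) :
    E.card ≤ 2 * k * ν := by
  obtain ⟨a, l, h1, h2⟩ := exists_card_le ν E hE hdeg hν
  have h3 := sum_map_oddBound_le (l := l) fun m _ => oddBound_le k m
  nlinarith [Nat.mul_le_mul_left (2 * k) h1]

/-- The theorem of Abbott, Hanson and Sauer, even case. -/
theorem card_le_of_even (hE : ∀ e ∈ E, e.card = 2) {j : ℕ}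
    (hdeg : ∀ v, (E.filter fun e => v ∈ e).card ≤ 2 * j)
    (hν : ∀ M ⊆ E, (M : Set (Finset V)).PairwiseDisjoint id → M.card ≤ 2 * j) :
    E.card ≤ (2 * j + 1) * (2 * j) := by
  obtain ⟨a, l, h1, h2⟩ := exists_card_le _ E hE hdeg hν
  have h3 := sum_map_oddBound_le (l := l) fun m _ => oddBound_even_le j m
  nlinarith [Nat.mul_le_mul_left (2 * j + 1) h1]

/-- The theorem of Abbott, Hanson and Sauer, odd case. -/
theorem card_le_of_odd (hE : ∀ e ∈ E, e.card = 2) {j : ℕ}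
    (hdeg : ∀ v, (E.filter fun e => v ∈ e).card ≤ 2 * j + 1)
    (hν : ∀ M ⊆ E, (M : Set (Finset V)).PairwiseDisjoint id → M.card ≤ 2 * j + 1) :
    E.card ≤ (2 * j + 1) ^ 2 + j := by
  obtain ⟨a, l, h1, h2⟩ := exists_card_le _ E hE hdeg hν
  have h3 := sum_map_oddBound_odd_le (j := j) (l := l) (by omega)
  nlinarith [Nat.mul_le_mul_left (2 * j + 1) h1]

end SetMatching

/-! ### Links and codegrees in star-free 3-graphs -/

namespace KGraph

open Finset

variable {V : Type*} [DecidableEq V]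

/-- The link of `x`: the pairs that form an edge together with `x`. -/
def link (G : KGraph 3 V) (x : V) : Finset (Finset V) :=
  (G.edges.filter (x ∈ ·)).image (·.erase x)

theorem mem_link {G : KGraph 3 V} {x : V} {p : Finset V} :
    p ∈ G.link x ↔ x ∉ p ∧ insert x p ∈ G.edges := by
  simp only [link, mem_image, mem_filter]
  constructor
  · rintro ⟨e, ⟨he, hx⟩, rfl⟩
    exact ⟨notMem_erase _ _, by rwa [insert_erase hx]⟩
  · rintro ⟨hx, he⟩
    exact ⟨_, ⟨he, mem_insert_self _ _⟩, erase_insert hx⟩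

theorem card_of_mem_link {G : KGraph 3 V} {x : V} {p : Finset V} (hp : p ∈ G.link x) :
    p.card = 2 := by
  obtain ⟨hx, he⟩ := mem_link.mp hp
  have := G.uniform he
  rw [card_insert_of_notMem hx] at this
  omega

theorem contains_star_of_injective {G : KGraph 3 V} {s : ℕ} {v : V} (g : Fin s × Fin 2 → V)
    (hg : Function.Injective g) (hv : ∀ i, g i ≠ v)
    (hG : ∀ i, {v, g (i, 0), g (i, 1)} ∈ G.edges) : G.Contains (star s) := by
  refine ⟨⟨fun o => o.elim v g, ?_⟩, ?_⟩
  · rintro (_ | a) (_ | b) h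
    · rfl
    · exact (hv b h.symm).elim
    · exact (hv a h).elim
    · exact congrArg some (hg h)
  · intro e he
    obtain ⟨i, -, rfl⟩ := mem_image.mp he
    rw [map_insert, map_insert, map_singleton]
    exact hG i

/-- In a star-free `3`-graph every matching in a link is small. -/
theorem Free.card_matching_lt {G : KGraph 3 V} {s : ℕ} (hG : G.Free (star s)) {v : V}
    {M : Finset (Finset V)} (hM : M ⊆ G.link v) (hMd : (M : Set (Finset V)).PairwiseDisjoint id) :
    M.card < s := by
  by_contra! hs
  obtain ⟨M', hM', hcard⟩ := exists_subset_card_eq hs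
  let φ : Fin s ≃ M' := (M'.equivFinOfCardEq hcard).symm
  have hlink : ∀ i, (φ i : Finset V) ∈ G.link v := fun i => hM (hM' (φ i).2)
  choose a b hab hφ using fun i => card_eq_two.mp (card_of_mem_link (hlink i))
  have hdisj : ∀ i j x, x ∈ (φ i : Finset V) → x ∈ (φ j : Finset V) → i = j := by
    intro i j x hi hj
    by_contra hij
    have hne : (φ i : Finset V) ≠ φ j := fun h => hij (φ.injective (Subtype.ext h))
    exact disjoint_left.mp (hMd (hM' (φ i).2) (hM' (φ j).2) hne) hi hj
  let g : Fin s × Fin 2 → V := fun q => if q.2 = 0 then a q.1 else b q.1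
  have hgmem : ∀ q, g q ∈ (φ q.1 : Finset V) := by
    intro q
    rw [hφ]
    by_cases h : q.2 = 0 <;> simp [g, h]
  refine hG (contains_star_of_injective (v := v) g ?_ ?_ ?_)
  · rintro ⟨i, c⟩ ⟨j, d⟩ h
    obtain rfl : i = j := hdisj i j _ (hgmem (i, c)) (h ▸ hgmem (j, d))
    have h1 := hab i
    have h2 := (hab i).symm
    fin_cases c <;> fin_cases d <;> simp_all [g]
  · intro q hq
    exact (mem_link.mp (hlink q.1)).1 (hq ▸ hgmem q)
  · intro i
    have := (mem_link.mp (hlink i)).2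
    rw [hφ] at this
    simpa [g] using this

theorem card_filter_mem_link_le (G : KGraph 3 V) (x y : V) :
    ((G.link x).filter (y ∈ ·)).card ≤ G.codegree {x, y} := by
  refine card_le_card_of_injOn (insert x) (fun p hp => ?_) (fun p hp q hq h => ?_)
  · obtain ⟨hp, hy⟩ := mem_filter.mp hp
    exact mem_filter.mpr ⟨(mem_link.mp hp).2, by simp [insert_subset_iff, hy]⟩
  · rw [← erase_insert (mem_link.mp (mem_filter.mp hp).1).1, h,
      erase_insert (mem_link.mp (mem_filter.mp hq).1).1]

variable [Fintype V]

theorem codegree_le_card_filter_link (G : KGraph 3 V) {p : Finset V} (hp : p.card = 2) :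
    G.codegree p ≤ (univ.filter fun x => p ∈ G.link x).card := by
  refine (card_le_card (t := (univ.filter fun x => p ∈ G.link x).image (insert · p)) ?_).trans
    card_image_le
  intro e he
  obtain ⟨he, hpe⟩ := mem_filter.mp he
  obtain ⟨x, hx, rfl⟩ : ∃ x, x ∉ p ∧ insert x p = e := by
    have h3 : (e \ p).card = 1 := by rw [card_sdiff_of_subset hpe, G.uniform he, hp]
    obtain ⟨x, hx⟩ := card_eq_one.mp h3
    have hxm : x ∈ e \ p := by simp [hx]
    refine ⟨x, (mem_sdiff.mp hxm).2, ?_⟩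
    rw [insert_eq, ← hx, sdiff_union_of_subset hpe]
  exact mem_image.mpr ⟨x, mem_filter.mpr ⟨mem_univ _, mem_link.mpr ⟨hx, he⟩⟩, rfl⟩

theorem codegree_le_card (G : KGraph 3 V) {p : Finset V} (hp : p.card = 2) :
    G.codegree p ≤ Fintype.card V :=
  (G.codegree_le_card_filter_link hp).trans (card_le_univ _)

theorem sum_codegree_le (G : KGraph 3 V) {H : Finset (Finset V)} (hH : ∀ p ∈ H, p.card = 2) :
    ∑ p ∈ H, G.codegree p ≤ ∑ x, ((G.link x).filter (· ∈ H)).card := by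
  refine (sum_le_sum fun p hp => G.codegree_le_card_filter_link (hH p hp)).trans_eq ?_
  have := sum_card_bipartiteAbove_eq_sum_card_bipartiteBelow (s := H) (t := (univ : Finset V))
    (fun p x => p ∈ G.link x)
  simp only [bipartiteAbove, bipartiteBelow] at this
  rw [this]
  refine sum_congr rfl fun x _ => congrArg card ?_
  ext p
  simp [and_comm]

/-! ### Heavy pairs and the upper bound -/

/-- The pairs of codegree at least `c`. -/
def heavy (G : KGraph 3 V) (c : ℕ) : Finset (Finset V) :=
  (univ.powersetCard 2).filter fun p => c ≤ G.codegree p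

theorem card_of_mem_heavy {G : KGraph 3 V} {c : ℕ} {p : Finset V} (hp : p ∈ G.heavy c) :
    p.card = 2 :=
  (mem_powersetCard.mp (mem_filter.mp hp).1).2

/-- The pairs of large codegree in a star-free `3`-graph form a graph of small maximum degree. -/
theorem Free.card_heavy_lt {G : KGraph 3 V} {s : ℕ} (hG : G.Free (star s)) (v : V) :
    ((G.heavy (2 * s)).filter (v ∈ ·)).card < s := by
  by_contra! hs
  obtain ⟨K, hK, hcard⟩ := exists_subset_card_eq hs
  have hKv : ∀ p ∈ K, v ∈ p := fun p hp => (mem_filter.mp (hK hp)).2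
  have hKh : ∀ p ∈ K, p ∈ G.heavy (2 * s) := fun p hp => (mem_filter.mp (hK hp)).1
  let U : Finset V := (K.biUnion id).erase v
  have hU : U.card ≤ s := by
    have : U ⊆ K.biUnion fun p => p.erase v := by
      intro x hx
      obtain ⟨hxv, hx⟩ := mem_erase.mp hx
      obtain ⟨p, hp, hxp⟩ := mem_biUnion.mp hx
      exact mem_biUnion.mpr ⟨p, hp, mem_erase.mpr ⟨hxv, hxp⟩⟩
    refine (card_le_card this).trans ((card_biUnion_le_card_mul _ _ 1 fun p hp => ?_).trans ?_)
    · rw [card_erase_of_mem (hKv p hp), card_of_mem_heavy (hKh p hp)]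
    · omega
  -- Each pair has at least `2 * s` extensions, of which at most `s` lie in `U`. At least `s`
  -- remain, so Hall's condition for `s` pairs is automatic.
  let N : K → Finset V := fun p => (univ.filter fun x => (p : Finset V) ∈ G.link x) \ U
  have hN : ∀ p, s ≤ (N p).card := by
    intro p
    have h1 := (mem_filter.mp (hKh p p.2)).2
    have h2 := G.codegree_le_card_filter_link (card_of_mem_heavy (hKh p p.2))
    have h3 := le_card_sdiff U (univ.filter fun x => (p : Finset V) ∈ G.link x)
    change s ≤ ((univ.filter fun x => (p : Finset V) ∈ G.link x) \ U).card
    omega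
  obtain ⟨f, hf, hfN⟩ := (all_card_le_biUnion_card_iff_exists_injective N).mp (by
    intro S
    rcases S.eq_empty_or_nonempty with rfl | ⟨p, hp⟩
    · simp
    · calc S.card ≤ Fintype.card K := card_le_univ _
        _ = s := by rw [Fintype.card_coe, hcard]
        _ ≤ (N p).card := hN p
        _ ≤ _ := card_le_card (subset_biUnion_of_mem N hp))
  have hfl : ∀ p, (p : Finset V) ∈ G.link (f p) := fun p =>
    (mem_filter.mp (mem_sdiff.mp (hfN p)).1).2
  have hfU : ∀ p, f p ∉ U := fun p => (mem_sdiff.mp (hfN p)).2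
  have hfv : ∀ p, f p ≠ v := fun p h => (mem_link.mp (hfl p)).1 (h ▸ hKv p p.2)
  -- Replacing `v` by the chosen extension turns the `s` heavy pairs at `v` into a matching in the
  -- link of `v`.
  let e : K → Finset V := fun p => insert (f p) ((p : Finset V).erase v)
  have hdisj : ∀ p q, p ≠ q → Disjoint (e p) (e q) := by
    intro p q hpq
    refine disjoint_left.mpr fun x hx hy => ?_
    have hmemU : ∀ r : K, x ∈ (r : Finset V).erase v → x ∈ U := fun r hr =>
      mem_erase.mpr ⟨(mem_erase.mp hr).1, mem_biUnion.mpr ⟨r, r.2, (mem_erase.mp hr).2⟩⟩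
    rcases mem_insert.mp hx with rfl | hx <;> rcases mem_insert.mp hy with h | hy
    · exact hpq (hf h)
    · exact hfU p (hmemU q hy)
    · exact hfU q (h ▸ hmemU p hx)
    · obtain ⟨hxv, hx⟩ := mem_erase.mp hx
      have hy := (mem_erase.mp hy).2
      have key : ∀ r : K, x ∈ (r : Finset V) → (r : Finset V) = {v, x} := fun r hr => by
        refine (eq_of_subset_of_card_le ?_ ?_).symm
        · simp [insert_subset_iff, hr, hKv r r.2]
        · rw [card_of_mem_heavy (hKh r r.2), card_pair hxv.symm]
      exact hpq (Subtype.ext ((key p hx).trans (key q hy).symm))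
  have hinj : Function.Injective e := by
    intro p q h
    by_contra hpq
    have := hdisj p q hpq
    rw [h, disjoint_self_iff_empty] at this
    exact (insert_ne_empty _ _ this)
  have := hG.card_matching_lt (v := v) (M := univ.image e) (by
      intro x hx
      obtain ⟨p, -, rfl⟩ := mem_image.mp hx
      refine mem_link.mpr ⟨by simp [e, (hfv p).symm], ?_⟩
      rw [Finset.insert_comm, insert_erase (hKv p p.2)]
      exact (mem_link.mp (hfl p)).2) (by
      intro x hx y hy hxy
      obtain ⟨p, -, rfl⟩ := mem_image.mp (mem_coe.mp hx)
      obtain ⟨q, -, rfl⟩ := mem_image.mp (mem_coe.mp hy)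
      exact hdisj p q fun h => hxy (h ▸ rfl))
  rw [card_image_of_injective _ hinj, card_univ, Fintype.card_coe, hcard] at this
  exact lt_irrefl _ this

/-- The number of edges of a star-free `3`-graph is at most linear in the number of vertices. -/
theorem Free.card_edges_le {G : KGraph 3 V} {s f : ℕ} (hG : G.Free (star s))
    (hf : ∀ x, ((G.link x).filter (· ∈ G.heavy (2 * s))).card ≤ f) :
    G.edges.card ≤ (f + 4 * s * s) * Fintype.card V := by
  -- These link pairs come from edges without heavy pairs. For such a pair through `y`, the pair
  -- `{x, y}` is light, so degrees in `D x` are bounded as well as matchings.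
  let D : V → Finset (Finset V) := fun x =>
    (G.link x).filter fun p => ∀ q ∈ G.heavy (2 * s), ¬ q ⊆ insert x p
  have hD : ∀ x, (D x).card ≤ 4 * s * s := by
    intro x
    refine (SetMatching.card_le_two_mul (k := 2 * s) (ν := s)
      (fun p hp => card_of_mem_link (mem_filter.mp hp).1) (fun y => ?_)
      (fun M hM hMd => (hG.card_matching_lt (hM.trans (filter_subset _ _)) hMd).le)).trans_eq
      (by ring)
    change ((D x).filter (y ∈ ·)).card ≤ 2 * s
    rcases ((D x).filter (y ∈ ·)).eq_empty_or_nonempty with h | ⟨p, hp⟩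
    · rw [h, card_empty]
      exact Nat.zero_le _
    · obtain ⟨hp, hyp⟩ := mem_filter.mp hp
      obtain ⟨hpl, hp⟩ := mem_filter.mp hp
      have hxy : x ≠ y := fun h => (mem_link.mp hpl).1 (h ▸ hyp)
      have hlight : ¬ 2 * s ≤ G.codegree {x, y} := fun hle =>
        hp {x, y} (mem_filter.mpr ⟨by simp [card_pair hxy], hle⟩)
          (by simp [insert_subset_iff, hyp])
      exact (card_le_card (filter_subset_filter _ (filter_subset _ _))).trans
        ((G.card_filter_mem_link_le x y).trans (by omega))
  have hsub : G.edges ⊆ ((G.heavy (2 * s)).biUnion fun q => G.edges.filter (q ⊆ ·)) ∪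
      univ.biUnion fun x => (D x).image (insert x) := by
    intro e he
    by_cases h : ∃ q ∈ G.heavy (2 * s), q ⊆ e
    · obtain ⟨q, hq, hqe⟩ := h
      exact mem_union_left _ (mem_biUnion.mpr ⟨q, hq, mem_filter.mpr ⟨he, hqe⟩⟩)
    · push Not at h
      obtain ⟨x, hx⟩ : e.Nonempty := card_pos.mp (by rw [G.uniform he]; omega)
      refine mem_union_right _ (mem_biUnion.mpr ⟨x, mem_univ _, mem_image.mpr
        ⟨e.erase x, mem_filter.mpr ⟨mem_link.mpr ⟨notMem_erase _ _, ?_⟩, ?_⟩,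
          insert_erase hx⟩⟩)
      · rwa [insert_erase hx]
      · rwa [insert_erase hx]
  calc G.edges.card
      ≤ ∑ q ∈ G.heavy (2 * s), G.codegree q + ∑ x, ((D x).image (insert x)).card :=
        (card_le_card hsub).trans ((card_union_le _ _).trans
          (add_le_add card_biUnion_le card_biUnion_le))
    _ ≤ ∑ x : V, f + ∑ x : V, 4 * s * s := by
        refine add_le_add ?_ (sum_le_sum fun x _ => card_image_le.trans (hD x))
        exact (G.sum_codegree_le fun p hp => card_of_mem_heavy hp).trans
          (sum_le_sum fun x _ => hf x)
    _ = _ := by simp only [sum_const, smul_eq_mul, card_univ]; ring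

theorem sum_codegree (G : KGraph 3 V) :
    ∑ p ∈ univ.powersetCard 2, G.codegree p = 3 * G.edges.card := by
  have := sum_card_bipartiteAbove_eq_sum_card_bipartiteBelow
    (s := (univ : Finset V).powersetCard 2) (t := G.edges) (fun p e => p ⊆ e)
  simp only [bipartiteAbove, bipartiteBelow] at this
  refine this.trans ?_
  rw [mul_comm]
  refine sum_const_nat fun e he => ?_
  have h : ((univ : Finset V).powersetCard 2).filter (· ⊆ e) = e.powersetCard 2 := by
    ext p
    simp [mem_powersetCard, and_comm]
  rw [h, card_powersetCard, G.uniform he]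
  rfl

/-- The upper bound: the heavy pairs contribute at most `f * n ^ 2`, the light ones `O(n)`. -/
theorem Free.co2_le {G : KGraph 3 V} {s f : ℕ} (hG : G.Free (star s))
    (hf : ∀ x, ((G.link x).filter (· ∈ G.heavy (2 * s))).card ≤ f) :
    G.co2 ≤ f * Fintype.card V ^ 2 + 6 * s * (f + 4 * s * s) * Fintype.card V := by
  have hH := G.sum_codegree_le (H := G.heavy (2 * s)) fun p hp => card_of_mem_heavy hp
  have hH' : ∑ p ∈ G.heavy (2 * s), G.codegree p ≤ f * Fintype.card V :=
    hH.trans ((sum_le_sum fun x _ => hf x).trans_eq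
      (by rw [sum_const, smul_eq_mul, card_univ, mul_comm]))
  have h1 : ∑ p ∈ G.heavy (2 * s), G.codegree p ^ 2 ≤ f * Fintype.card V ^ 2 := by
    calc _ ≤ ∑ p ∈ G.heavy (2 * s), G.codegree p * Fintype.card V := by
          refine sum_le_sum fun p hp => ?_
          rw [sq]
          exact Nat.mul_le_mul_left _ (G.codegree_le_card (card_of_mem_heavy hp))
      _ = (∑ p ∈ G.heavy (2 * s), G.codegree p) * Fintype.card V := (sum_mul _ _ _).symm
      _ ≤ _ := by rw [sq, ← mul_assoc]; exact Nat.mul_le_mul_right _ hH'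
  have h2 : ∑ p ∈ (univ.powersetCard 2).filter (fun p => ¬ 2 * s ≤ G.codegree p),
      G.codegree p ^ 2 ≤ 2 * s * (3 * G.edges.card) := by
    calc _ ≤ ∑ p ∈ (univ.powersetCard 2).filter (fun p => ¬ 2 * s ≤ G.codegree p),
            2 * s * G.codegree p := by
          refine sum_le_sum fun p hp => ?_
          rw [sq]
          exact Nat.mul_le_mul_right _ (not_le.mp (mem_filter.mp hp).2).le
      _ ≤ ∑ p ∈ univ.powersetCard 2, 2 * s * G.codegree p :=
          sum_le_sum_of_subset (filter_subset _ _)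
      _ = _ := by rw [← mul_sum, G.sum_codegree]
  have h3 := Nat.mul_le_mul_left (6 * s) (hG.card_edges_le hf)
  have h4 : G.co2 = ∑ p ∈ univ.powersetCard 2, G.codegree p ^ 2 := rfl
  rw [h4, ← sum_filter_add_sum_filter_not _ (fun p => 2 * s ≤ G.codegree p)]
  refine add_le_add h1 (h2.trans ?_)
  calc _ = 6 * s * G.edges.card := by ring
    _ ≤ _ := h3
    _ = _ := by ring

theorem Free.co2_le_of_odd {G : KGraph 3 V} {j : ℕ} (hG : G.Free (star (2 * j + 1))) :
    G.co2 ≤ (2 * j + 1) * (2 * j) * Fintype.card V ^ 2 + 6 * (2 * j + 1) *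
      ((2 * j + 1) * (2 * j) + 4 * (2 * j + 1) * (2 * j + 1)) * Fintype.card V :=
  hG.co2_le fun x => SetMatching.card_le_of_even
    (fun p hp => card_of_mem_link (mem_filter.mp hp).1)
    (fun v => Nat.le_of_lt_succ ((card_le_card fun p hp => by
      simp only [mem_filter] at hp ⊢
      exact ⟨hp.1.2, hp.2⟩).trans_lt (hG.card_heavy_lt v)))
    (fun M hM hMd => Nat.le_of_lt_succ (hG.card_matching_lt (hM.trans (filter_subset _ _)) hMd))

theorem Free.co2_le_of_even {G : KGraph 3 V} {j : ℕ} (hG : G.Free (star (2 * j + 2))) :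
    G.co2 ≤ ((2 * j + 1) ^ 2 + j) * Fintype.card V ^ 2 + 6 * (2 * j + 2) *
      ((2 * j + 1) ^ 2 + j + 4 * (2 * j + 2) * (2 * j + 2)) * Fintype.card V :=
  hG.co2_le fun x => SetMatching.card_le_of_odd
    (fun p hp => card_of_mem_link (mem_filter.mp hp).1)
    (fun v => Nat.le_of_lt_succ ((card_le_card fun p hp => by
      simp only [mem_filter] at hp ⊢
      exact ⟨hp.1.2, hp.2⟩).trans_lt (hG.card_heavy_lt v)))
    (fun M hM hMd => Nat.le_of_lt_succ (hG.card_matching_lt (hM.trans (filter_subset _ _)) hMd))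

end KGraph

/-! ### Lower bound by suspending a fixed graph -/

namespace KGraph

open Finset

section Suspension

variable {V W : Type*} [DecidableEq V] [Fintype V] [Fintype W]

/-- The `3`-graph on `V` whose edges are the triples that meet the copy of `W` exactly in an edge
of the graph `E`. -/
def suspension (E : Finset (Finset W)) (f : W ↪ V) : KGraph 3 V where
  edges := (univ.powersetCard 3).filter fun T => ∃ e ∈ E, T ∩ univ.map f = e.map f
  uniform := fun _ hT => (mem_powersetCard.mp (mem_filter.mp hT).1).2

theorem mem_edges_suspension {E : Finset (Finset W)} {f : W ↪ V} {T : Finset V} :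
    T ∈ (suspension E f).edges ↔ T.card = 3 ∧ ∃ e ∈ E, T ∩ univ.map f = e.map f := by
  simp [suspension, mem_powersetCard]

theorem le_co2_suspension {E : Finset (Finset W)} (hE : ∀ e ∈ E, e.card = 2) (f : W ↪ V) :
    E.card * (Fintype.card V - Fintype.card W) ^ 2 ≤ (suspension E f).co2 := by
  have hcod : ∀ e ∈ E, Fintype.card V - Fintype.card W ≤ (suspension E f).codegree (e.map f) := by
    intro e he
    have hcompl : ((univ.map f)ᶜ : Finset V).card = Fintype.card V - Fintype.card W := by
      rw [card_compl, card_map, card_univ]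
    have hsub : e.map f ⊆ univ.map f := map_subset_map.mpr (subset_univ e)
    rw [← hcompl]
    refine card_le_card_of_injOn (insert · (e.map f)) (fun x hx => ?_) (fun x hx y hy hxy => ?_)
    · have hx : x ∉ univ.map f := mem_compl.mp hx
      refine mem_filter.mpr ⟨mem_edges_suspension.mpr ⟨?_, e, he, ?_⟩, subset_insert _ _⟩
      · rw [card_insert_of_notMem fun h => hx (hsub h), card_map, hE e he]
      · rw [insert_inter_of_notMem hx, inter_eq_left.mpr hsub]
    · have hx : x ∉ univ.map f := mem_compl.mp (mem_coe.mp hx)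
      have h : x ∈ insert y (e.map f) := by
        rw [← show insert x (e.map f) = insert y (e.map f) from hxy]
        exact mem_insert_self _ _
      exact (mem_insert.mp h).resolve_right fun h => hx (hsub h)
  have hsub : E.map (mapEmbedding f).toEmbedding ⊆ (univ : Finset V).powersetCard 2 := by
    intro p hp
    obtain ⟨e, he, rfl⟩ := mem_map.mp hp
    refine mem_powersetCard.mpr ⟨subset_univ _, ?_⟩
    exact (card_map f).trans (hE e he)
  calc E.card * (Fintype.card V - Fintype.card W) ^ 2
      = ∑ e ∈ E, (Fintype.card V - Fintype.card W) ^ 2 := by rw [sum_const, smul_eq_mul]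
    _ ≤ ∑ e ∈ E, (suspension E f).codegree (e.map f) ^ 2 :=
        sum_le_sum fun e he => Nat.pow_le_pow_left (hcod e he) 2
    _ = ∑ p ∈ E.map (mapEmbedding f).toEmbedding, (suspension E f).codegree p ^ 2 := by
        rw [sum_map]; rfl
    _ ≤ _ := sum_le_sum_of_subset hsub

variable [DecidableEq W]

/-- The edges of a star in the suspension have distinct traces in `E`, since a trace has two
vertices and star edges share only the center. If the center lies in the copy of `W`, all traces
contain it, against the degree bound; otherwise they are disjoint, against the matching bound. -/
theorem suspension_free {E : Finset (Finset W)} (hE : ∀ e ∈ E, e.card = 2) {s : ℕ}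
    (hdeg : ∀ w, (E.filter (w ∈ ·)).card < s)
    (hmat : ∀ M ⊆ E, (M : Set (Finset W)).PairwiseDisjoint id → M.card < s) (f : W ↪ V) :
    (suspension E f).Free (star s) := by
  rintro ⟨F, hF⟩
  let T : Fin s → Finset V := fun i => {F none, F (some (i, 0)), F (some (i, 1))}
  have hT : ∀ i, T i ∈ (suspension E f).edges := fun i => by
    have := hF _ (mem_image_of_mem _ (mem_univ i))
    rwa [map_insert, map_insert, map_singleton] at this
  have hinter : ∀ i j x, i ≠ j → x ∈ T i → x ∈ T j → x = F none := by
    intro i j x hij hi hj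
    simp only [T, mem_insert, mem_singleton] at hi hj
    rcases hi with rfl | rfl | rfl
    · rfl
    all_goals
      simp only [F.injective.eq_iff] at hj
      simp [hij] at hj
  choose e heE he using fun i => (mem_edges_suspension.mp (hT i)).2
  have hsub : ∀ i w, w ∈ e i → f w ∈ T i := fun i w hw => by
    have : f w ∈ T i ∩ univ.map f := he i ▸ mem_map_of_mem f hw
    exact (mem_inter.mp this).1
  have hinj : Function.Injective e := by
    intro i j hij
    by_contra hne
    obtain ⟨a, b, hab, heab⟩ := card_eq_two.mp (hE _ (heE i))
    have h : ∀ w ∈ e i, f w = F none := fun w hw =>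
      hinter i j _ hne (hsub i w hw) (hsub j w (hij ▸ hw))
    exact hab (f.injective ((h a (by simp [heab])).trans (h b (by simp [heab])).symm))
  have hcard : (univ.image e).card = s := by
    rw [card_image_of_injective _ hinj, card_univ, Fintype.card_fin]
  by_cases hv : ∃ w, f w = F none
  · obtain ⟨w, hw⟩ := hv
    refine (hdeg w).not_ge (hcard.ge.trans (card_le_card fun p hp => ?_))
    obtain ⟨i, -, rfl⟩ := mem_image.mp hp
    refine mem_filter.mpr ⟨heE i, ?_⟩
    have h1 : f w ∈ T i ∩ univ.map f :=
      mem_inter.mpr ⟨by simp [T, hw], mem_map_of_mem f (mem_univ w)⟩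
    rw [he i] at h1
    exact (mem_map' f).mp h1
  · push Not at hv
    refine (hmat (univ.image e) ?_ ?_).ne hcard
    · intro p hp
      obtain ⟨i, -, rfl⟩ := mem_image.mp hp
      exact heE i
    · intro p hp q hq hpq
      obtain ⟨i, -, rfl⟩ := mem_image.mp (mem_coe.mp hp)
      obtain ⟨j, -, rfl⟩ := mem_image.mp (mem_coe.mp hq)
      have hij : i ≠ j := fun h => hpq (h ▸ rfl)
      exact disjoint_left.mpr fun w hi hj =>
        hv w (hinter i j _ hij (hsub i w hi) (hsub j w hj))

end Suspension

theorem star_edges_nonempty {s : ℕ} (hs : 0 < s) : (star s).edges.Nonempty :=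
  ⟨_, mem_image_of_mem _ (mem_univ (⟨0, hs⟩ : Fin s))⟩

theorem le_exco2_star {W : Type*} [DecidableEq W] [Fintype W] {E : Finset (Finset W)}
    (hE : ∀ e ∈ E, e.card = 2) {s : ℕ} (hs : 0 < s) (hdeg : ∀ w, (E.filter (w ∈ ·)).card < s)
    (hmat : ∀ M ⊆ E, (M : Set (Finset W)).PairwiseDisjoint id → M.card < s) {n : ℕ}
    (hn : Fintype.card W ≤ n) :
    E.card * (n - Fintype.card W) ^ 2 ≤ exco2 n (star s) := by
  obtain ⟨f⟩ : Nonempty (W ↪ Fin n) :=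
    Function.Embedding.nonempty_of_card_le (by rwa [Fintype.card_fin])
  have := le_co2_suspension hE f
  rw [Fintype.card_fin] at this
  exact this.trans ((isGreatest_exco2 n _ (star_edges_nonempty hs)).2
    ⟨_, suspension_free hE hdeg hmat f, rfl⟩)

/-! ### Extremal graphs for the two parities -/

section Constructions

theorem card_filter_mem_le_of_subset {W : Type*} [DecidableEq W] {E : Finset (Finset W)} {w : W}
    (N : Finset W) (h : ∀ e ∈ E, w ∈ e → ∃ u ∈ N, e = {w, u}) :
    (E.filter (w ∈ ·)).card ≤ N.card := by
  refine (card_le_card (t := N.image fun u => {w, u}) fun e he => ?_).trans card_image_le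
  obtain ⟨he, hw⟩ := mem_filter.mp he
  obtain ⟨u, hu, rfl⟩ := h e he hw
  exact mem_image_of_mem _ hu

theorem two_mul_card_matching_le {W : Type*} [DecidableEq W] {M : Finset (Finset W)}
    (h2 : ∀ e ∈ M, e.card = 2) (hM : (M : Set (Finset W)).PairwiseDisjoint id) {A : Finset W}
    (hA : ∀ e ∈ M, e ⊆ A) : 2 * M.card ≤ A.card := by
  rw [← SetMatching.card_biUnion_of_disjoint h2 hM]
  exact card_le_card (biUnion_subset.mpr hA)

/-- For odd `s`, the extremal graph consists of two disjoint cliques on `s` vertices. -/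
theorem le_exco2_star_of_odd {j n : ℕ} (hn : 2 * (2 * j + 1) ≤ n) :
    (2 * j + 1) * (2 * j) * (n - 2 * (2 * j + 1)) ^ 2 ≤ exco2 n (star (2 * j + 1)) := by
  let A : Finset (Fin (2 * j + 1) ⊕ Fin (2 * j + 1)) := univ.map .inl
  let B : Finset (Fin (2 * j + 1) ⊕ Fin (2 * j + 1)) := univ.map .inr
  have hA : A.card = 2 * j + 1 := by simp [A]
  have hB : B.card = 2 * j + 1 := by simp [B]
  have hAB : Disjoint A B := by
    refine disjoint_left.mpr fun x hx hy => ?_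
    simp only [A, B, mem_map, mem_univ, true_and, Function.Embedding.inl_apply,
      Function.Embedding.inr_apply] at hx hy
    obtain ⟨a, rfl⟩ := hx
    obtain ⟨b, hb⟩ := hy
    cases hb
  have hE : ∀ e ∈ A.powersetCard 2 ∪ B.powersetCard 2, e.card = 2 := by
    intro e he
    rcases mem_union.mp he with h | h <;> exact (mem_powersetCard.mp h).2
  have hdeg : ∀ C D : Finset (Fin (2 * j + 1) ⊕ Fin (2 * j + 1)), Disjoint C D →
      C.card = 2 * j + 1 → ∀ w ∈ C,
      ((C.powersetCard 2 ∪ D.powersetCard 2).filter (w ∈ ·)).card < 2 * j + 1 := by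
    intro C D hCD hC w hw
    refine (card_filter_mem_le_of_subset (C.erase w) fun e he hwe => ?_).trans_lt ?_
    · rcases mem_union.mp he with h | h
      · obtain ⟨hsub, h2⟩ := mem_powersetCard.mp h
        obtain ⟨u, hu⟩ := card_eq_one.mp
          (show (e.erase w).card = 1 by rw [card_erase_of_mem hwe, h2])
        refine ⟨u, erase_subset_erase w hsub (hu ▸ mem_singleton_self u), ?_⟩
        rw [← insert_erase hwe, hu]
      · exact (disjoint_left.mp hCD hw ((mem_powersetCard.mp h).1 hwe)).elim
    · rw [card_erase_of_mem hw, hC]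
      omega
  have hcard : (A.powersetCard 2 ∪ B.powersetCard 2).card = (2 * j + 1) * (2 * j) := by
    rw [card_union_of_disjoint, card_powersetCard, card_powersetCard, hA, hB, ← two_mul,
      Nat.choose_two_right, Nat.add_sub_cancel,
      Nat.mul_div_cancel' ((even_two_mul j).mul_left _).two_dvd]
    refine disjoint_left.mpr fun e h1 h2 => ?_
    obtain ⟨x, hx⟩ : e.Nonempty := card_pos.mp (by rw [(mem_powersetCard.mp h1).2]; omega)
    exact disjoint_left.mp hAB ((mem_powersetCard.mp h1).1 hx) ((mem_powersetCard.mp h2).1 hx)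
  have hW : Fintype.card (Fin (2 * j + 1) ⊕ Fin (2 * j + 1)) = 2 * (2 * j + 1) := by
    simp [two_mul]
  have := le_exco2_star hE (s := 2 * j + 1) (by omega) (fun w => ?_) (fun M hM hMd => ?_)
    (n := n) (by rwa [hW])
  · rwa [hcard, hW] at this
  · rcases w with w | w
    · exact hdeg A B hAB hA _ (by simp [A])
    · rw [union_comm]
      exact hdeg B A hAB.symm hB _ (by simp [B])
  -- Each clique has the odd order `2 * j + 1`, so a matching has at most `j` edges in it and at
  -- most `2 * j` in total.
  · have h1 := two_mul_card_matching_le (M := M.filter (· ⊆ A)) (A := A)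
      (fun e he => hE e (hM (mem_filter.mp he).1))
      (hMd.subset (coe_subset.mpr (filter_subset _ _))) fun e he => (mem_filter.mp he).2
    have h2 := two_mul_card_matching_le (M := M.filter (¬ · ⊆ A)) (A := B)
      (fun e he => hE e (hM (mem_filter.mp he).1))
      (hMd.subset (coe_subset.mpr (filter_subset _ _))) fun e he => by
        obtain ⟨he, heA⟩ := mem_filter.mp he
        exact (mem_powersetCard.mp ((mem_union.mp (hM he)).resolve_left fun h =>
          heA (mem_powersetCard.mp h).1)).1
    have h3 := card_filter_add_card_filter_not (s := M) (· ⊆ A)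
    omega

/-- For even `s`, the extremal graph has `2 * s - 1` vertices, one of degree `s - 2` and all
others of degree `s - 1`. It is obtained from the complete bipartite graph with parts of size
`s - 1` and `s` by deleting a maximum matching and adding a matching in the larger part. -/
theorem le_exco2_star_of_even {j n : ℕ} (hn : 4 * j + 3 ≤ n) :
    ((2 * j + 1) ^ 2 + j) * (n - (4 * j + 3)) ^ 2 ≤ exco2 n (star (2 * j + 2)) := by
  let k := 2 * j + 1
  let W := Fin k ⊕ Fin (k + 1)
  -- The deleted matching is the diagonal `i ↦ i.castSucc`. The added edges `ψ` pair `2 * i` with `2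
  -- * i + 1` below `2 * j`, leaving the last two vertices of the larger part unpaired.
  let P : Finset (Fin k × Fin (k + 1)) := univ.filter fun q => q.1.castSucc ≠ q.2
  let φ : Fin k × Fin (k + 1) → Finset W := fun q => {.inl q.1, .inr q.2}
  let ψ : Fin j → Finset W := fun i =>
    {.inr ⟨2 * i, by omega⟩, .inr ⟨2 * i + 1, by omega⟩}
  let E : Finset (Finset W) := P.image φ ∪ univ.image ψ
  have hW : Fintype.card W = 4 * j + 3 := by
    simp only [W, k, Fintype.card_sum, Fintype.card_fin]
    omega
  have hφ : Function.Injective φ := by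
    rintro ⟨a, b⟩ ⟨c, d⟩ h
    have h1 : (Sum.inl a : W) ∈ φ (c, d) := h ▸ by simp [φ]
    have h2 : (Sum.inr b : W) ∈ φ (c, d) := h ▸ by simp [φ]
    simp only [φ, mem_insert, mem_singleton, Sum.inl.injEq, Sum.inr.injEq, reduceCtorEq, or_false,
      false_or] at h1 h2
    rw [h1, h2]
  have hψ : Function.Injective ψ := by
    intro a b h
    have h1 : (Sum.inr ⟨2 * a, by omega⟩ : W) ∈ ψ b := h ▸ by simp [ψ]
    simp only [ψ, mem_insert, mem_singleton, Sum.inr.injEq, Fin.mk.injEq] at h1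
    exact Fin.ext (by omega)
  have hP : P.card = k ^ 2 := by
    have h1 := card_filter_add_card_filter_not (s := (univ : Finset (Fin k × Fin (k + 1))))
      (fun q => q.1.castSucc = q.2)
    have h2 : (univ.filter fun q : Fin k × Fin (k + 1) => q.1.castSucc = q.2) =
        univ.image fun i : Fin k => (i, i.castSucc) := by
      ext ⟨a, b⟩
      simp [Prod.ext_iff]
    have h3 : (univ.image fun i : Fin k => (i, i.castSucc)).card = k := by
      rw [card_image_of_injective _ fun a b h => (Prod.ext_iff.mp h).1, card_univ,
        Fintype.card_fin]
    rw [h2, h3, card_univ, Fintype.card_prod, Fintype.card_fin, Fintype.card_fin] at h1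
    have h4 : P.card + k = k ^ 2 + k := by
      rw [add_comm, sq]
      exact h1.trans (by ring)
    omega
  have hcard : E.card = (2 * j + 1) ^ 2 + j := by
    rw [card_union_of_disjoint, card_image_of_injective _ hφ, card_image_of_injective _ hψ, hP,
      card_univ, Fintype.card_fin]
    refine disjoint_left.mpr fun e h1 h2 => ?_
    obtain ⟨⟨a, b⟩, -, rfl⟩ := mem_image.mp h1
    obtain ⟨i, -, h⟩ := mem_image.mp h2
    have h3 : (Sum.inl a : W) ∈ ψ i := h ▸ by simp [φ]
    simp [ψ] at h3
  have hE : ∀ e ∈ E, e.card = 2 := by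
    intro e he
    rcases mem_union.mp he with h | h
    · obtain ⟨q, -, rfl⟩ := mem_image.mp h
      exact card_pair (by simp)
    · obtain ⟨i, -, rfl⟩ := mem_image.mp h
      exact card_pair fun h => by simpa using Sum.inr.inj h
  have := le_exco2_star hE (s := 2 * j + 2) (by omega) (fun w => ?_) (fun M hM hMd => ?_)
    (n := n) (by rwa [hW])
  · rwa [hcard, hW] at this
  · refine Nat.lt_succ_of_le ?_
    rcases w with a | b
    · refine (card_filter_mem_le_of_subset ((univ.erase a.castSucc).image Sum.inr)
        fun e he hae => ?_).trans (card_image_le.trans ?_)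
      · rcases mem_union.mp he with h | h
        · obtain ⟨⟨c, d⟩, hq, rfl⟩ := mem_image.mp h
          have hq := (mem_filter.mp hq).2
          obtain rfl : a = c := by simpa [φ] using hae
          exact ⟨.inr d, mem_image_of_mem _ (mem_erase.mpr ⟨hq.symm, mem_univ _⟩), rfl⟩
        · obtain ⟨i, -, rfl⟩ := mem_image.mp h
          simp [ψ] at hae
      · rw [card_erase_of_mem (mem_univ _), card_univ, Fintype.card_fin]
        exact le_rfl
    · let N₁ : Finset W := (univ.filter fun a : Fin k => a.castSucc ≠ b).image Sum.inl
      -- The partner of `b` under `ψ`, if any, is the other index with the same half. A paired `b`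
      -- has lost its diagonal neighbour, which makes room for it.
      let N₂ : Finset W := (univ.filter fun d : Fin (k + 1) =>
        (b : ℕ) < 2 * j ∧ d ≠ b ∧ (d : ℕ) / 2 = (b : ℕ) / 2).image Sum.inr
      refine (card_filter_mem_le_of_subset (N₁ ∪ N₂) fun e he hbe => ?_).trans
        ((card_union_le _ _).trans ((add_le_add card_image_le card_image_le).trans ?_))
      · rcases mem_union.mp he with h | h
        · obtain ⟨⟨c, d⟩, hq, rfl⟩ := mem_image.mp h
          have hq := (mem_filter.mp hq).2
          obtain rfl : b = d :=
            Sum.inr.inj (mem_singleton.mp ((mem_insert.mp hbe).resolve_left Sum.inr_ne_inl))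
          exact ⟨.inl c, mem_union_left _ (mem_image_of_mem _ (mem_filter.mpr ⟨mem_univ _, hq⟩)),
            pair_comm _ _⟩
        · obtain ⟨i, -, rfl⟩ := mem_image.mp h
          simp only [ψ, mem_insert, mem_singleton] at hbe
          rcases hbe.imp Sum.inr.inj Sum.inr.inj with rfl | rfl
          · refine ⟨.inr ⟨2 * i + 1, by omega⟩, mem_union_right _ (mem_image_of_mem _
              (mem_filter.mpr ⟨mem_univ _, ?_, ?_, ?_⟩)), rfl⟩
            · simp
            · simp
            · simp only
              omega
          · refine ⟨.inr ⟨2 * i, by omega⟩, mem_union_right _ (mem_image_of_mem _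
              (mem_filter.mpr ⟨mem_univ _, ?_, ?_, ?_⟩)), pair_comm _ _⟩
            · simp only
              omega
            · simp
            · simp only
              omega
      · by_cases hb : (b : ℕ) < 2 * j
        · have h1 : (univ.filter fun a : Fin k => a.castSucc ≠ b).card ≤ 2 * j := by
            have hsub : (univ.filter fun a : Fin k => a.castSucc ≠ b) ⊆
                univ.erase (⟨b, by omega⟩ : Fin k) := fun a ha => by
              refine mem_erase.mpr ⟨fun h => (mem_filter.mp ha).2 ?_, mem_univ _⟩
              rw [h]
              rfl
            refine (card_le_card hsub).trans ?_
            rw [card_erase_of_mem (mem_univ _), card_univ, Fintype.card_fin]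
            exact le_rfl
          have h2 : (univ.filter fun d : Fin (k + 1) =>
              (b : ℕ) < 2 * j ∧ d ≠ b ∧ (d : ℕ) / 2 = (b : ℕ) / 2).card ≤ 1 := by
            refine card_le_one.mpr fun c hc d hd => ?_
            obtain ⟨-, hc, hc'⟩ := (mem_filter.mp hc).2
            obtain ⟨-, hd, hd'⟩ := (mem_filter.mp hd).2
            rw [Ne, Fin.ext_iff] at hc hd
            exact Fin.ext (by omega)
          omega
        · have h1 : (univ.filter fun a : Fin k => a.castSucc ≠ b).card ≤ 2 * j + 1 :=
            (card_le_univ _).trans_eq (Fintype.card_fin k)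
          have h2 : (univ.filter fun d : Fin (k + 1) =>
              (b : ℕ) < 2 * j ∧ d ≠ b ∧ (d : ℕ) / 2 = (b : ℕ) / 2).card = 0 := by
            simp [hb]
          omega
  -- On `4 * j + 3` vertices a matching has at most `2 * j + 1` edges.
  · have h := two_mul_card_matching_le (A := univ) (fun e he => hE e (hM he)) hMd
      fun e _ => subset_univ e
    rw [card_univ, hW] at h
    omega

end Constructions

end KGraph

/-! ### From explicit bounds to the asymptotics -/

open KGraph in
theorem exco2_star_le {s a c : ℕ} (hs : 0 < s)
    (h : ∀ (n : ℕ) (G : KGraph 3 (Fin n)), G.Free (star s) → G.co2 ≤ a * n ^ 2 + c * n) (n : ℕ) :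
    exco2 n (star s) ≤ a * n ^ 2 + c * n := by
  obtain ⟨G, hG, hGn⟩ := (isGreatest_exco2 n _ (star_edges_nonempty hs)).1
  exact hGn ▸ h n G hG

theorem isEquivalent_sq_of_bounds {f : ℕ → ℕ} {a b c : ℕ} (ha : 0 < a)
    (hlow : ∀ n, b ≤ n → a * (n - b) ^ 2 ≤ f n) (hup : ∀ n, f n ≤ a * n ^ 2 + c * n) :
    Asymptotics.IsEquivalent Filter.atTop (fun n => (f n : ℝ))
      (fun n : ℕ => (a : ℝ) * (n : ℝ) ^ 2) := by
  have hO : ((fun n => (f n : ℝ)) - fun n : ℕ => (a : ℝ) * (n : ℝ) ^ 2) =O[Filter.atTop]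
      fun n : ℕ => (n : ℝ) := by
    -- The lower bound loses at most `2 * a * b * n` when `a * (n - b) ^ 2` is expanded; the upper
    -- bound exceeds the main term by `c * n`.
    refine Asymptotics.IsBigO.of_bound (2 * a * b + c) ?_
    filter_upwards [Filter.eventually_ge_atTop b] with n hn
    have h1 : (a : ℝ) * ((n : ℝ) - b) ^ 2 ≤ f n := by
      have := hlow n hn
      rw [← Nat.cast_sub hn]
      exact_mod_cast this
    have h2 : (f n : ℝ) ≤ a * (n : ℝ) ^ 2 + c * n := by exact_mod_cast hup n
    rw [Pi.sub_apply, Real.norm_eq_abs, Real.norm_eq_abs, Nat.abs_cast, abs_le]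
    have h3 : (0 : ℝ) ≤ c * n := by positivity
    have h4 : (0 : ℝ) ≤ a * b * n := by positivity
    have h5 : (0 : ℝ) ≤ a * b ^ 2 := by positivity
    constructor <;> nlinarith
  have ho : (fun n : ℕ => (n : ℝ)) =o[Filter.atTop] fun n : ℕ => (a : ℝ) * (n : ℝ) ^ 2 := by
    refine Asymptotics.IsLittleO.const_mul_right (by positivity) ?_
    have := (Asymptotics.isLittleO_pow_pow_atTop_of_lt (𝕜 := ℝ) one_lt_two).comp_tendsto
      (tendsto_natCast_atTop_atTop (R := ℝ))
    simpa [Function.comp_def] using this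
  exact hO.trans_isLittleO ho

theorem theorem1p6 (s : ℕ) (hs : 3 ≤ s) :
    (Odd s →
      Asymptotics.IsEquivalent Filter.atTop
        (fun n : ℕ => (KGraph.exco2 n (KGraph.star s) : ℝ))
        (fun n : ℕ => (s : ℝ) * ((s : ℝ) - 1) * (n : ℝ) ^ 2)) ∧
    (Even s →
      Asymptotics.IsEquivalent Filter.atTop
        (fun n : ℕ => (KGraph.exco2 n (KGraph.star s) : ℝ))
        (fun n : ℕ => ((s : ℝ) ^ 2 - 3 / 2 * (s : ℝ)) * (n : ℝ) ^ 2)) := by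
  constructor
  · rintro ⟨j, rfl⟩
    have := isEquivalent_sq_of_bounds (a := (2 * j + 1) * (2 * j))
      (Nat.mul_pos (by omega) (by omega))
      (fun n hn => KGraph.le_exco2_star_of_odd hn)
      (exco2_star_le (by omega) fun n G hG => by simpa using hG.co2_le_of_odd)
    push_cast at this ⊢
    simpa using this
  · intro h
    obtain ⟨j, rfl⟩ : ∃ j, s = 2 * j + 2 := by
      obtain ⟨i, rfl⟩ := h
      exact ⟨i - 1, by omega⟩
    have := isEquivalent_sq_of_bounds (a := (2 * j + 1) ^ 2 + j) (by positivity)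
      (fun n hn => KGraph.le_exco2_star_of_even hn)
      (exco2_star_le (by omega) fun n G hG => by simpa using hG.co2_le_of_even)
    have hf : ((2 * j + 2 : ℕ) : ℝ) ^ 2 - 3 / 2 * ((2 * j + 2 : ℕ) : ℝ) =
        (((2 * j + 1) ^ 2 + j : ℕ) : ℝ) := by
      push_cast
      ring
    rwa [hf]
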